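/- Let $\mathcal C$ be a (strict) braided monoidal category with tensor product $\otimes$, unit object $K$ and braiding $c$, which admits equalizers and coequalizers. Let $H$ be an object of $\mathcal C$ with a monoid structure $(\eta,\mu)$ and a counital comagma structure $(\varepsilon,\delta)$, i.e. $\delta:H\to H\otimes H$ (not assumed coassociative) and $\varepsilon:H\to K$ satisfy $(\varepsilon\otimes H)\circ\delta=\mathrm{id}_H=(H\otimes\varepsilon)\circ\delta$. (We write $H$ for $\mathrm{id}_H$ in tensor products.) Assume (b1) $\delta\circ\mu=(\mu\otimes\mu)\circ(H\otimes c_{H,H}\otimes H)\circ(\delta\otimes\delta)$; (b2) $\varepsilon\circ\mu\circ(\mu\otimes H)=((\varepsilon\circ\mu)\otimes(\varepsilon\circ\mu))\circ(H\otimes\delta\otimes H)=((\varepsilon\circ\mu)\otimes(\varepsilon\circ\mu))\circ(H\otimes(c_{H,H}^{-1}\circ\delta)\otimes H)$; (b3) $(\delta\otimes H)\circ\delta\circ\eta=(H\otimes\delta)\circ\delta\circ\eta=(H\otimes\mu\otimes H)\circ((\delta\circ\eta)\otimes(\delta\circ\eta))=(H\otimes(\mu\circ c_{H,H}^{-1})\otimes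 H)\circ((\delta\circ\eta)\otimes(\delta\circ\eta))$. Put $$\Pi^L=((\varepsilon\circ\mu)\otimes H)\circ(H\otimes c_{H,H})\circ((\delta\circ\eta)\otimes H),\qquad \Pi^R=(H\otimes(\varepsilon\circ\mu))\circ(c_{H,H}\otimes H)\circ(H\otimes(\delta\circ\eta)),$$ $$\beta=(\mu\otimes H)\circ(H\otimes\delta),\qquad \gamma=(H\otimes\mu)\circ(\delta\otimes H),$$ and, for $\sigma\in\{L,R\}$, $$\Omega_\sigma^1=(\mu\otimes H)\circ(H\otimes\Pi^\sigma\otimes H)\circ(H\otimes\delta),\qquad \Omega_\sigma^2=(H\otimes\mu)\circ(H\otimes\Pi^\sigma\otimes H)\circ(\delta\otimes H).$$ Each $\Omega_\sigma^\alpha$ is a split idempotent: there are an object $H\times_\sigma^\alpha H$ and morphisms $q_\sigma^\alpha:H\otimes H\to H\times_\sigma^\alpha H$, $j_\sigma^\alpha:H\times_\sigma^\alpha H\to H\otimes H$ with $j_\sigma^\alpha\circ q_\sigma^\alpha=\Omega_\sigma^\alpha$ and $q_\sigma^\alpha\circ j_\sigma^\alpha=\mathrm{id}$. For every choice of these splittings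 the following are equivalent. (i) $H$ is a weak Hopf coquasigroup, i.e. besides (b1)–(b3) there is a morphism $\lambda:H\to H$ such that, with $f\ast g=\mu\circ(f\otimes g)\circ\delta$, $\Pi^L=\mathrm{id}_H\ast\lambda$, $\ \Pi^R=\lambda\ast\mathrm{id}_H$, $\ \lambda\ast\Pi^L=\Pi^R\ast\lambda=\lambda$, $(\mu\otimes H)\circ(\lambda\otimes\delta)\circ\delta=(\Pi^R\otimes H)\circ\delta$, $(\mu\otimes H)\circ(H\otimes\lambda\otimes H)\circ(H\otimes\delta)\circ\delta=(\Pi^L\otimes H)\circ\delta$, $(H\otimes\mu)\circ(\delta\otimes\lambda)\circ\delta=(H\otimes\Pi^L)\circ\delta$, and $(H\otimes\mu)\circ(H\otimes\lambda\otimes H)\circ(\delta\otimes H)\circ\delta=(H\otimes\Pi^R)\circ\delta$. (ii) The morphisms $h=q_L^2\circ\gamma\circ j_R^2:H\times_R^2H\to H\times_L^2H$ and $s=q_R^1\circ\beta\circ j_L^1:H\times_L^1H\to H\times_R^1H$ are isomorphisms; moreover $\phi=j_R^2\circ h^{-1}\circ q_L^2$ is almost left $H$-colinear, i.e. $\phi=(H\otimes\varepsilon\otimes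 H)\circ(H\otimes\phi)\circ(\delta\otimes H)$, and $\psi=j_L^1\circ s^{-1}\circ q_R^1$ is almost right $H$-colinear, i.e. $\psi=(H\otimes\varepsilon\otimes H)\circ(\psi\otimes H)\circ(H\otimes\delta)$. -/

import Mathlib

open CategoryTheory MonoidalCategory Limits
open scoped MonObj

universe v u

/-- A counital comagma in a monoidal category: an object with a coproduct (not assumed
coassociative) and a two-sided counit. -/
class CounitalComagma {C : Type u} [Category.{v} C] [MonoidalCategory C] (X : C) where
  /-- The counit. -/
  counit : X ⟶ 𝟙_ C
  /-- The coproduct. -/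
  comul : X ⟶ X ⊗ X
  counit_comul : comul ≫ counit ▷ X ≫ (λ_ X).hom = 𝟙 X
  comul_counit : comul ≫ X ◁ counit ≫ (ρ_ X).hom = 𝟙 X

notation "δ[" X "]" => @CounitalComagma.comul _ _ _ X _
notation "ε[" X "]" => @CounitalComagma.counit _ _ _ X _

/-- A splitting of an endomorphism `e`: an object together with `q : X ⟶ obj` and `j : obj ⟶ X`
such that `j ∘ q = e` and `q ∘ j = id`. -/
structure Splitting {C : Type u} [Category.{v} C] {X : C} (e : X ⟶ X) where
  /-- The image object. -/
  obj : C
  /-- The inclusion. -/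
  j : obj ⟶ X
  /-- The projection. -/
  q : X ⟶ obj
  q_j : q ≫ j = e
  j_q : j ≫ q = 𝟙 obj

namespace WeakHopf

variable {C : Type u} [Category.{v} C] [MonoidalCategory C]

/-- `φ = (H ⊗ ε ⊗ H) ∘ (H ⊗ φ) ∘ (δ ⊗ H)`. -/
def AlmostLeftColinear {H : C} [CounitalComagma H] (φ : H ⊗ H ⟶ H ⊗ H) : Prop :=
  φ = δ[H] ▷ H ≫ (α_ H H H).hom ≫ H ◁ φ ≫ H ◁ (ε[H] ▷ H) ≫ H ◁ (λ_ H).hom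

/-- `φ = (H ⊗ ε ⊗ H) ∘ (φ ⊗ H) ∘ (H ⊗ δ)`. -/
def AlmostRightColinear {H : C} [CounitalComagma H] (φ : H ⊗ H ⟶ H ⊗ H) : Prop :=
  φ = H ◁ δ[H] ≫ (α_ H H H).inv ≫ φ ▷ H ≫ (H ◁ ε[H]) ▷ H ≫ (ρ_ H).hom ▷ H

/-- The convolution product `f ∗ g = μ ∘ (f ⊗ g) ∘ δ`. -/
def conv {H : C} [MonObj H] [CounitalComagma H] (f g : H ⟶ H) : H ⟶ H :=
  δ[H] ≫ (f ⊗ₘ g) ≫ μ[H]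

variable (H : C) [MonObj H] [CounitalComagma H]

/-- The right Galois morphism `(μ ⊗ H) ∘ (H ⊗ δ)`. -/
def galoisBeta : H ⊗ H ⟶ H ⊗ H :=
  H ◁ δ[H] ≫ (α_ H H H).inv ≫ μ[H] ▷ H

/-- The left Galois morphism `(H ⊗ μ) ∘ (δ ⊗ H)`. -/
def galoisGamma : H ⊗ H ⟶ H ⊗ H :=
  δ[H] ▷ H ≫ (α_ H H H).hom ≫ H ◁ μ[H]

variable [BraidedCategory C]

/-- The target morphism `((ε ∘ μ) ⊗ H) ∘ (H ⊗ c) ∘ ((δ ∘ η) ⊗ H)`. -/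
def piL : H ⟶ H :=
  (λ_ H).inv ≫ (η[H] ≫ δ[H]) ▷ H ≫ (α_ H H H).hom ≫ H ◁ (β_ H H).hom ≫ (α_ H H H).inv ≫
    (μ[H] ≫ ε[H]) ▷ H ≫ (λ_ H).hom

/-- The source morphism `(H ⊗ (ε ∘ μ)) ∘ (c ⊗ H) ∘ (H ⊗ (δ ∘ η))`. -/
def piR : H ⟶ H :=
  (ρ_ H).inv ≫ H ◁ (η[H] ≫ δ[H]) ≫ (α_ H H H).inv ≫ (β_ H H).hom ▷ H ≫ (α_ H H H).hom ≫
    H ◁ (μ[H] ≫ ε[H]) ≫ (ρ_ H).hom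

/-- `Ω_L^1 = (μ ⊗ H) ∘ (H ⊗ Π^L ⊗ H) ∘ (H ⊗ δ)`. -/
def omegaL1 : H ⊗ H ⟶ H ⊗ H :=
  H ◁ δ[H] ≫ (α_ H H H).inv ≫ (H ◁ piL H) ▷ H ≫ μ[H] ▷ H

/-- `Ω_R^1 = (μ ⊗ H) ∘ (H ⊗ Π^R ⊗ H) ∘ (H ⊗ δ)`. -/
def omegaR1 : H ⊗ H ⟶ H ⊗ H :=
  H ◁ δ[H] ≫ (α_ H H H).inv ≫ (H ◁ piR H) ▷ H ≫ μ[H] ▷ H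

/-- `Ω_L^2 = (H ⊗ μ) ∘ (H ⊗ Π^L ⊗ H) ∘ (δ ⊗ H)`. -/
def omegaL2 : H ⊗ H ⟶ H ⊗ H :=
  δ[H] ▷ H ≫ (α_ H H H).hom ≫ H ◁ (piL H ▷ H) ≫ H ◁ μ[H]

/-- `Ω_R^2 = (H ⊗ μ) ∘ (H ⊗ Π^R ⊗ H) ∘ (δ ⊗ H)`. -/
def omegaR2 : H ⊗ H ⟶ H ⊗ H :=
  δ[H] ▷ H ≫ (α_ H H H).hom ≫ H ◁ (piR H ▷ H) ≫ H ◁ μ[H]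

/-- `δ ∘ μ = (μ ⊗ μ) ∘ δ_{H ⊗ H}`, with `δ_{H ⊗ H} = (H ⊗ c ⊗ H) ∘ (δ ⊗ δ)`. -/
def CondB1 : Prop :=
  μ[H] ≫ δ[H] = (δ[H] ⊗ₘ δ[H]) ≫ tensorμ H H H H ≫ (μ[H] ⊗ₘ μ[H])

/-- `((ε ∘ μ) ⊗ (ε ∘ μ)) ∘ (H ⊗ d ⊗ H)` for `d : H ⟶ H ⊗ H`. -/
def counitPairing (d : H ⟶ H ⊗ H) : (H ⊗ H) ⊗ H ⟶ 𝟙_ C :=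
  (H ◁ d) ▷ H ≫ (α_ H H H).inv ▷ H ≫ (α_ (H ⊗ H) H H).hom ≫
    ((μ[H] ≫ ε[H]) ⊗ₘ (μ[H] ≫ ε[H])) ≫ (λ_ (𝟙_ C)).hom

/-- `ε ∘ μ ∘ (μ ⊗ H) = ((ε ∘ μ) ⊗ (ε ∘ μ)) ∘ (H ⊗ δ ⊗ H)
= ((ε ∘ μ) ⊗ (ε ∘ μ)) ∘ (H ⊗ (c⁻¹ ∘ δ) ⊗ H)`. -/
def CondB2 : Prop :=
  μ[H] ▷ H ≫ μ[H] ≫ ε[H] = counitPairing H δ[H] ∧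
  μ[H] ▷ H ≫ μ[H] ≫ ε[H] = counitPairing H (δ[H] ≫ (β_ H H).inv)

/-- `(H ⊗ m ⊗ H) ∘ ((δ ∘ η) ⊗ (δ ∘ η))` for `m : H ⊗ H ⟶ H`. -/
def unitCopairing (m : H ⊗ H ⟶ H) : 𝟙_ C ⟶ (H ⊗ H) ⊗ H :=
  (λ_ (𝟙_ C)).inv ≫ ((η[H] ≫ δ[H]) ⊗ₘ (η[H] ≫ δ[H])) ≫ (α_ (H ⊗ H) H H).inv ≫
    (α_ H H H).hom ▷ H ≫ (H ◁ m) ▷ H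

/-- `(δ ⊗ H) ∘ δ ∘ η = (H ⊗ δ) ∘ δ ∘ η = (H ⊗ μ ⊗ H) ∘ ((δ ∘ η) ⊗ (δ ∘ η))
= (H ⊗ (μ ∘ c⁻¹) ⊗ H) ∘ ((δ ∘ η) ⊗ (δ ∘ η))`. -/
def CondB3 : Prop :=
  η[H] ≫ δ[H] ≫ δ[H] ▷ H = η[H] ≫ δ[H] ≫ H ◁ δ[H] ≫ (α_ H H H).inv ∧
  η[H] ≫ δ[H] ≫ δ[H] ▷ H = unitCopairing H μ[H] ∧
  η[H] ≫ δ[H] ≫ δ[H] ▷ H = unitCopairing H ((β_ H H).inv ≫ μ[H])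

/-- `lam` is an antipode for `H`. -/
structure IsAntipode (lam : H ⟶ H) : Prop where
  /-- `Π^L = id ∗ lam` -/
  id_conv : piL H = conv (𝟙 H) lam
  /-- `Π^R = lam ∗ id` -/
  conv_id : piR H = conv lam (𝟙 H)
  /-- `lam ∗ Π^L = lam` -/
  conv_piL : conv lam (piL H) = lam
  /-- `Π^R ∗ lam = lam` -/
  piR_conv : conv (piR H) lam = lam
  /-- `(μ ⊗ H) ∘ (lam ⊗ δ) ∘ δ = (Π^R ⊗ H) ∘ δ` -/
  left_piR : δ[H] ≫ (lam ⊗ₘ δ[H]) ≫ (α_ H H H).inv ≫ μ[H] ▷ H = δ[H] ≫ piR H ▷ H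
  /-- `(μ ⊗ H) ∘ (H ⊗ lam ⊗ H) ∘ (H ⊗ δ) ∘ δ = (Π^L ⊗ H) ∘ δ` -/
  left_piL : δ[H] ≫ H ◁ δ[H] ≫ (α_ H H H).inv ≫ (H ◁ lam) ▷ H ≫ μ[H] ▷ H = δ[H] ≫ piL H ▷ H
  /-- `(H ⊗ μ) ∘ (δ ⊗ lam) ∘ δ = (H ⊗ Π^L) ∘ δ` -/
  right_piL : δ[H] ≫ (δ[H] ⊗ₘ lam) ≫ (α_ H H H).hom ≫ H ◁ μ[H] = δ[H] ≫ H ◁ piL H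
  /-- `(H ⊗ μ) ∘ (H ⊗ lam ⊗ H) ∘ (δ ⊗ H) ∘ δ = (H ⊗ Π^R) ∘ δ` -/
  right_piR : δ[H] ≫ δ[H] ▷ H ≫ (α_ H H H).hom ≫ H ◁ (lam ▷ H) ≫ H ◁ μ[H] = δ[H] ≫ H ◁ piR H

/-- The monoid and counital comagma `H` is a weak Hopf coquasigroup. -/
structure IsWeakHopfCoquasigroup : Prop where
  condB1 : CondB1 H
  condB2 : CondB2 H
  condB3 : CondB3 H
  exists_antipode : ∃ lam : H ⟶ H, IsAntipode H lam

end WeakHopf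

/-!
The idempotents `Ω_L^1`, `Ω_R^1` and the Galois morphism `β` are linear for the action of `H` on the
first tensor factor, that is, of the form `x ⊗ h ↦ x f(h)` with `f : H ⟶ H ⊗ H`. By (b1)–(b3), `β`
is a morphism `(H ⊗ H, Ω_L^1) ⟶ (H ⊗ H, Ω_R^1)` of the Karoubi envelope, and `s` is invertible if
and only if `β` is so there, with inverse `ψ`. This inverse is again linear, and almost colinearity
says precisely that it comes from `f(h) = λ(h₁) ⊗ h₂` for some `λ`. The equations of an inverse then
become those antipode axioms that involve `β`. The axioms that involve `γ` are the same ones in the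
monoidal opposite category, and a left and a right antipode agree by the usual associativity
argument.
-/

section Splittings

variable {C : Type u} [Category.{v} C] {X Y : C} {e : X ⟶ X} {f : Y ⟶ Y}
  {b : X ⟶ Y} {b' : Y ⟶ X}

/-- `b'` is an inverse of `b : (X, e) ⟶ (Y, f)` in the Karoubi envelope. -/
structure IsKaroubiInverse (e : X ⟶ X) (f : Y ⟶ Y) (b : X ⟶ Y) (b' : Y ⟶ X) : Prop where
  hom_inv_id : b ≫ b' = e
  inv_hom_id : b' ≫ b = f
  comp_inv : f ≫ b' = b'

lemma IsKaroubiInverse.inv_comp (h : IsKaroubiInverse e f b b') : b' ≫ e = b' := by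
  rw [← h.hom_inv_id, reassoc_of% h.inv_hom_id, h.comp_inv]

lemma IsKaroubiInverse.map_comp (h : IsKaroubiInverse e f b b') {T : C ⥤ C}
    {a : T.obj X ⟶ X} {a' : T.obj Y ⟶ Y} (he : a ≫ e = T.map e ≫ a) (hf : a' ≫ f = T.map f ≫ a')
    (hb : a ≫ b = T.map b ≫ a') : a' ≫ b' = T.map b' ≫ a := by
  calc
    a' ≫ b' = T.map b' ≫ (T.map b ≫ a') ≫ b' := by
      rw [Category.assoc, ← T.map_comp_assoc, h.inv_hom_id, ← reassoc_of% hf, h.comp_inv]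
    _ = T.map b' ≫ a := by
      rw [← hb, Category.assoc, h.hom_inv_id, he, ← T.map_comp_assoc, h.inv_comp]

namespace Splitting

lemma nonempty_of_idem [IsIdempotentComplete C] (he : e ≫ e = e) : Nonempty (Splitting e) := by
  obtain ⟨Y, j, q, hj, hq⟩ := IsIdempotentComplete.idempotents_split X e he
  exact ⟨⟨Y, j, q, hq, hj⟩⟩

lemma comp_q (E : Splitting e) : e ≫ E.q = E.q := by
  have h := E.q_j =≫ E.q
  rw [← h, Category.assoc, E.j_q, Category.comp_id]

/-- A splitting of `e`, seen in the monoidal opposite, whose arrows keep their direction. -/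
def mop (E : Splitting e) : Splitting e.mop where
  obj := MonoidalOpposite.mop E.obj
  j := E.j.mop
  q := E.q.mop
  q_j := congrArg Quiver.Hom.mop E.q_j
  j_q := congrArg Quiver.Hom.mop E.j_q

end Splitting

lemma IsKaroubiInverse.exists_isIso (h : IsKaroubiInverse e f b b') (E : Splitting e)
    (F : Splitting f) : ∃ _ : IsIso (E.j ≫ b ≫ F.q), F.q ≫ inv (E.j ≫ b ≫ F.q) ≫ E.j = b' := by
  have hom_inv_id : (E.j ≫ b ≫ F.q) ≫ F.j ≫ b' ≫ E.q = 𝟙 E.obj := by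
    simp only [Category.assoc, reassoc_of% F.q_j, reassoc_of% h.comp_inv,
      reassoc_of% h.hom_inv_id, E.comp_q, E.j_q]
  have inv_hom_id : (F.j ≫ b' ≫ E.q) ≫ E.j ≫ b ≫ F.q = 𝟙 F.obj := by
    simp only [Category.assoc, reassoc_of% E.q_j, reassoc_of% h.inv_comp,
      reassoc_of% h.inv_hom_id, F.comp_q, F.j_q]
  have hs : IsIso (E.j ≫ b ≫ F.q) := ⟨_, hom_inv_id, inv_hom_id⟩
  refine ⟨hs, ?_⟩
  rw [IsIso.inv_eq_of_hom_inv_id hom_inv_id]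
  simp only [Category.assoc, reassoc_of% F.q_j, E.q_j, h.inv_comp, h.comp_inv]

lemma isKaroubiInverse_of_isIso (E : Splitting e) (F : Splitting f) (he : e ≫ b = b)
    (hf : b ≫ f = b) [IsIso (E.j ≫ b ≫ F.q)] :
    IsKaroubiInverse e f b (F.q ≫ inv (E.j ≫ b ≫ F.q) ≫ E.j) := by
  have hb : b = E.q ≫ (E.j ≫ b ≫ F.q) ≫ F.j := by
    simp only [Category.assoc, F.q_j, hf, reassoc_of% E.q_j, he]
  generalize E.j ≫ b ≫ F.q = s at *
  constructor
  · rw [hb]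
    simp [reassoc_of% F.j_q, E.q_j]
  · rw [hb]
    simp [reassoc_of% E.j_q, F.q_j]
  · rw [reassoc_of% F.comp_q]

lemma inv_mop (b : X ⟶ Y) [IsIso b] : inv b.mop = (inv b).mop :=
  IsIso.inv_eq_of_hom_inv_id (congrArg Quiver.Hom.mop (IsIso.hom_inv_id b))

end Splittings

namespace WeakHopf

section Elements

variable {C : Type u} [Category.{v} C] [MonoidalCategory C] {A B D : C} [MonObj A] [MonObj B]

/-- Right multiplication `a ↦ a x` by an element `x : 𝟙_ C ⟶ A` of a monoid. -/
def mulRight (x : 𝟙_ C ⟶ A) : A ⟶ A :=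
  (ρ_ A).inv ≫ A ◁ x ≫ μ[A]

/-- Left multiplication `a ↦ x a` by an element `x : 𝟙_ C ⟶ A` of a monoid. -/
def mulLeft (x : 𝟙_ C ⟶ A) : A ⟶ A :=
  (λ_ A).inv ≫ x ▷ A ≫ μ[A]

/-- A morphism of the underlying semigroups of two monoids: it need not preserve the unit. -/
def IsMulHom (f : A ⟶ B) : Prop :=
  μ[A] ≫ f = (f ⊗ₘ f) ≫ μ[B]

@[simp]
lemma mulRight_one : mulRight η[A] = 𝟙 A := by simp [mulRight]

@[simp]
lemma mulLeft_one : mulLeft η[A] = 𝟙 A := by simp [mulLeft]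

lemma mulRight_comp_mulRight (x y : 𝟙_ C ⟶ A) :
    mulRight x ≫ mulRight y = mulRight (x ≫ mulRight y) := by
  calc
    _ = 𝟙 _ ⊗≫ A ◁ x ⊗≫ (μ[A] ▷ 𝟙_ C ≫ A ◁ y) ⊗≫ μ[A] := by
      dsimp only [mulRight]; monoidal
    _ = 𝟙 _ ⊗≫ A ◁ x ⊗≫ (A ⊗ A) ◁ y ⊗≫ (μ[A] ▷ A ≫ μ[A]) := by
      rw [← whisker_exchange]; monoidal
    _ = _ := by rw [MonObj.mul_assoc]; dsimp only [mulRight]; monoidal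

lemma mulLeft_comp_mulLeft (x y : 𝟙_ C ⟶ A) :
    mulLeft y ≫ mulLeft x = mulLeft (y ≫ mulLeft x) := by
  calc
    _ = 𝟙 _ ⊗≫ y ▷ A ⊗≫ (𝟙_ C ◁ μ[A] ≫ x ▷ A) ⊗≫ μ[A] := by
      dsimp only [mulLeft]; monoidal
    _ = 𝟙 _ ⊗≫ y ▷ A ⊗≫ x ▷ (A ⊗ A) ⊗≫ ((α_ A A A).hom ≫ A ◁ μ[A] ≫ μ[A]) := by
      rw [whisker_exchange]; monoidal
    _ = _ := by rw [← MonObj.mul_assoc]; dsimp only [mulLeft]; monoidal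

lemma IsMulHom.mulRight_comp {f : A ⟶ B} (hf : IsMulHom f) (x : 𝟙_ C ⟶ A) :
    mulRight x ≫ f = f ≫ mulRight (x ≫ f) := by
  simp only [mulRight, Category.assoc, show μ[A] ≫ f = _ from hf,
    MonoidalCategory.tensorHom_def', whiskerLeft_comp, rightUnitor_inv_naturality_assoc,
    whisker_exchange_assoc]

lemma IsMulHom.mulLeft_comp {f : A ⟶ B} (hf : IsMulHom f) (x : 𝟙_ C ⟶ A) :
    mulLeft x ≫ f = f ≫ mulLeft (x ≫ f) := by
  simp only [mulLeft, Category.assoc, show μ[A] ≫ f = _ from hf,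
    MonoidalCategory.tensorHom_def, comp_whiskerRight, leftUnitor_inv_naturality_assoc,
    whisker_exchange_assoc]

instance : IsMonHom η[A] where
  mul_hom := by simp [← unitors_equal]

/-- The inclusion `a ↦ a ⊗ 1`. -/
def inl (A B : C) [MonObj B] : A ⟶ A ⊗ B :=
  (ρ_ A).inv ≫ A ◁ η[B]

/-- The inclusion `b ↦ 1 ⊗ b`. -/
def inr (A B : C) [MonObj A] : B ⟶ A ⊗ B :=
  (λ_ B).inv ≫ η[A] ▷ B

lemma comp_inr {X Y : C} (f : X ⟶ Y) : f ≫ inr A Y = inr A X ≫ A ◁ f := by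
  simp [inr, ← whisker_exchange]

lemma inr_whiskerRight (X Y : C) : inr A X ▷ Y ≫ (α_ A X Y).hom = inr A (X ⊗ Y) := by
  simp [inr]

variable [BraidedCategory C] [MonObj D]

lemma IsMulHom.whiskerLeft {f : A ⟶ B} (hf : IsMulHom f) : IsMulHom (D ◁ f) := by
  have hf' : μ[A] ≫ f = (f ⊗ₘ f) ≫ μ[B] := hf
  simp only [IsMulHom, MonObj.tensorObj.mul_def, ← id_tensorHom, Category.assoc,
    tensorHom_comp_tensorHom, Category.comp_id, hf', tensorμ_natural_assoc]
  simp

lemma isMulHom_inr : IsMulHom (inr A B) :=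
  IsMonHom.mul_hom ((λ_ B).inv ≫ η[A] ▷ B)

lemma mulRight_tensorHom (x : 𝟙_ C ⟶ A) (y : 𝟙_ C ⟶ B) :
    mulRight x ⊗ₘ mulRight y = mulRight ((λ_ (𝟙_ C)).inv ≫ (x ⊗ₘ y)) := by
  have h : (ρ_ (A ⊗ B)).inv ≫ (A ⊗ B) ◁ (λ_ (𝟙_ C)).inv ≫ tensorμ A B (𝟙_ C) (𝟙_ C) =
      (ρ_ A).inv ⊗ₘ (ρ_ B).inv := by
    rw [Iso.inv_comp_eq, tensor_right_unitality, Category.assoc, Category.assoc,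
      tensorHom_comp_tensorHom, Iso.hom_inv_id, Iso.hom_inv_id, id_tensorHom_id, Category.comp_id]
  simp only [mulRight, MonObj.tensorObj.mul_def, whiskerLeft_comp, Category.assoc,
    tensorμ_natural_right_assoc, reassoc_of% h, tensorHom_comp_tensorHom]

lemma mulLeft_tensorHom (x : 𝟙_ C ⟶ A) (y : 𝟙_ C ⟶ B) :
    mulLeft x ⊗ₘ mulLeft y = mulLeft ((λ_ (𝟙_ C)).inv ≫ (x ⊗ₘ y)) := by
  have h : (λ_ (A ⊗ B)).inv ≫ (λ_ (𝟙_ C)).inv ▷ (A ⊗ B) ≫ tensorμ (𝟙_ C) (𝟙_ C) A B =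
      (λ_ A).inv ⊗ₘ (λ_ B).inv := by
    rw [Iso.inv_comp_eq, tensor_left_unitality, Category.assoc, Category.assoc,
      tensorHom_comp_tensorHom, Iso.hom_inv_id, Iso.hom_inv_id, id_tensorHom_id, Category.comp_id]
  simp only [mulLeft, MonObj.tensorObj.mul_def, comp_whiskerRight, Category.assoc,
    tensorμ_natural_left_assoc, reassoc_of% h, tensorHom_comp_tensorHom]

lemma mulRight_whiskerRight (x : 𝟙_ C ⟶ A) : mulRight x ▷ B = mulRight (x ≫ inl A B) := by
  rw [← tensorHom_id, ← mulRight_one, mulRight_tensorHom]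
  congr 1
  simp [inl, MonoidalCategory.tensorHom_def, unitors_inv_equal]

lemma mulLeft_whiskerRight (x : 𝟙_ C ⟶ A) : mulLeft x ▷ B = mulLeft (x ≫ inl A B) := by
  rw [← tensorHom_id, ← mulLeft_one, mulLeft_tensorHom]
  congr 1
  simp [inl, MonoidalCategory.tensorHom_def, unitors_inv_equal]

lemma whiskerLeft_inr_mul : (A ⊗ B) ◁ inr A B ≫ μ[A ⊗ B] = (α_ A B B).hom ≫ A ◁ μ[B] := by
  calc
    _ = (A ⊗ B) ◁ (λ_ B).inv ≫ tensorμ A B (𝟙_ C) B ≫ ((A ◁ η[A] ≫ μ[A]) ⊗ₘ μ[B]) := by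
      simp only [inr, MonObj.tensorObj.mul_def, whiskerLeft_comp, Category.assoc, ← tensorHom_id,
        tensorμ_natural_right_assoc, tensorHom_comp_tensorHom, whiskerLeft_id, Category.id_comp]
    _ = _ := by
      simp only [MonObj.mul_one, tensorμ, braiding_tensorUnit_right, MonoidalCategory.tensorHom_def]
      monoidal

lemma inr_whiskerRight_mul : inr A B ▷ (A ⊗ B) ≫ μ[A ⊗ B] =
    (α_ B A B).inv ≫ (β_ B A).hom ▷ B ≫ (α_ A B B).hom ≫ A ◁ μ[B] := by
  have h : (η[A] ▷ B) ▷ (A ⊗ B) ≫ tensorμ A B A B =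
      tensorμ (𝟙_ C) B A B ≫ (η[A] ▷ A ⊗ₘ 𝟙 _) := by
    simpa using tensorμ_natural_left η[A] (𝟙 B) A B
  calc
    _ = (λ_ B).inv ▷ (A ⊗ B) ≫ tensorμ (𝟙_ C) B A B ≫ ((η[A] ▷ A ≫ μ[A]) ⊗ₘ μ[B]) := by
      simp only [inr, MonObj.tensorObj.mul_def, comp_whiskerRight, Category.assoc,
        reassoc_of% h, tensorHom_comp_tensorHom, Category.id_comp]
    _ = _ := by
      simp only [MonObj.one_mul, tensorμ, MonoidalCategory.tensorHom_def]
      monoidal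

lemma inr_comp_mulLeft (x : 𝟙_ C ⟶ A ⊗ B) :
    inr A B ≫ mulLeft x = (λ_ B).inv ≫ x ▷ B ≫ (α_ A B B).hom ≫ A ◁ μ[B] := by
  rw [mulLeft, leftUnitor_inv_naturality_assoc, whisker_exchange_assoc, whiskerLeft_inr_mul]

lemma inr_comp_mulRight (x : 𝟙_ C ⟶ A ⊗ B) : inr A B ≫ mulRight x = (ρ_ B).inv ≫ B ◁ x ≫
    (α_ B A B).inv ≫ (β_ B A).hom ▷ B ≫ (α_ A B B).hom ≫ A ◁ μ[B] := by
  rw [mulRight, rightUnitor_inv_naturality_assoc, ← whisker_exchange_assoc, inr_whiskerRight_mul]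

lemma inr_comp_mulRight_eq_braiding_inv (x : 𝟙_ C ⟶ A ⊗ B) : inr A B ≫ mulRight x =
    (λ_ B).inv ≫ x ▷ B ≫ (α_ A B B).hom ≫ A ◁ ((β_ B B).inv ≫ μ[B]) := by
  have h : (ρ_ B).inv ≫ B ◁ x = (λ_ B).inv ≫ x ▷ B ≫ (β_ B (A ⊗ B)).inv := by
    rw [BraidedCategory.braiding_inv_naturality_left, braiding_inv_tensorUnit_right,
      Category.assoc, Iso.inv_hom_id_assoc]
  rw [inr_comp_mulRight, reassoc_of% h, BraidedCategory.braiding_tensor_right_inv]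
  simp

lemma inr_comp_mulLeft_whiskerRight (x : 𝟙_ C ⟶ A ⊗ B) :
    (inr A B ≫ mulLeft x) ▷ D ≫ (α_ A B D).hom =
    inr A (B ⊗ D) ≫ mulLeft (x ≫ inl (A ⊗ B) D ≫ (α_ A B D).hom) := by
  have h : IsMulHom (α_ A B D).hom := IsMonHom.mul_hom _
  rw [comp_whiskerRight, mulLeft_whiskerRight, Category.assoc, h.mulLeft_comp,
    reassoc_of% inr_whiskerRight, Category.assoc]

lemma inr_comp_mulRight_whiskerRight (x : 𝟙_ C ⟶ A ⊗ B) :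
    (inr A B ≫ mulRight x) ▷ D ≫ (α_ A B D).hom =
    inr A (B ⊗ D) ≫ mulRight (x ≫ inl (A ⊗ B) D ≫ (α_ A B D).hom) := by
  have h : IsMulHom (α_ A B D).hom := IsMonHom.mul_hom _
  rw [comp_whiskerRight, mulRight_whiskerRight, Category.assoc, h.mulRight_comp,
    reassoc_of% inr_whiskerRight, Category.assoc]

end Elements

section Colinearity

variable {C : Type u} [Category.{v} C] [MonoidalCategory C] {H : C} [CounitalComagma H]

/-- Right colinearity of `f : H ⟶ H ⊗ H`, for `H` coacting on the second factor of `H ⊗ H`. -/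
def IsRightColinear (f : H ⟶ H ⊗ H) : Prop :=
  f ≫ H ◁ δ[H] = δ[H] ≫ f ▷ H ≫ (α_ H H H).hom

lemma IsRightColinear.eq_comul_whiskerRight {f : H ⟶ H ⊗ H}
    (hf : IsRightColinear f) : f = δ[H] ≫ (f ≫ H ◁ ε[H] ≫ (ρ_ H).hom) ▷ H := by
  have h : f ≫ H ◁ δ[H] = δ[H] ≫ f ▷ H ≫ (α_ H H H).hom := hf
  calc
    f = f ≫ H ◁ (δ[H] ≫ ε[H] ▷ H ≫ (λ_ H).hom) := by
      rw [CounitalComagma.counit_comul, whiskerLeft_id, Category.comp_id]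
    _ = _ := by
      rw [whiskerLeft_comp, reassoc_of% h]
      monoidal

lemma IsRightColinear.whiskerRight {f : H ⟶ H ⊗ H}
    (hf : IsRightColinear f) (g : H ⟶ H) : IsRightColinear (f ≫ g ▷ H) := by
  have h : f ≫ H ◁ δ[H] = δ[H] ≫ f ▷ H ≫ (α_ H H H).hom := hf
  rw [IsRightColinear, Category.assoc, ← whisker_exchange, reassoc_of% h]
  simp

lemma comul_whiskerRight_counit (g : H ⟶ H) :
    (δ[H] ≫ g ▷ H) ≫ H ◁ ε[H] ≫ (ρ_ H).hom = g := by
  rw [Category.assoc, ← whisker_exchange_assoc, rightUnitor_naturality,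
    reassoc_of% CounitalComagma.comul_counit (X := H)]

end Colinearity

section LeftExtension

variable {C : Type u} [Category.{v} C] [MonoidalCategory C] {H : C} [MonObj H]

/-- The left `H`-linear extension `x ⊗ h ↦ x f(h)` of `f : H ⟶ H ⊗ H`, for `H` acting on the first
factor of `H ⊗ H`. -/
def leftExt (f : H ⟶ H ⊗ H) : H ⊗ H ⟶ H ⊗ H :=
  H ◁ f ≫ (α_ H H H).inv ≫ μ[H] ▷ H

/-- Linearity of an endomorphism of `H ⊗ H` for the action of `H` on the first factor. -/
def IsLeftLinear (ψ : H ⊗ H ⟶ H ⊗ H) : Prop :=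
  ((α_ H H H).inv ≫ μ[H] ▷ H) ≫ ψ = H ◁ ψ ≫ (α_ H H H).inv ≫ μ[H] ▷ H

lemma isLeftLinear_leftExt (f : H ⟶ H ⊗ H) : IsLeftLinear (leftExt f) := by
  calc
    _ = 𝟙 _ ⊗≫ (μ[H] ▷ H ≫ H ◁ f) ⊗≫ μ[H] ▷ H ⊗≫ 𝟙 _ := by
      dsimp only [leftExt]; monoidal
    _ = 𝟙 _ ⊗≫ H ◁ H ◁ f ⊗≫ (μ[H] ▷ H ≫ μ[H]) ▷ H ⊗≫ 𝟙 _ := by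
      rw [← whisker_exchange]; monoidal
    _ = _ := by
      rw [MonObj.mul_assoc]
      dsimp only [leftExt]; monoidal

lemma IsLeftLinear.eq_leftExt {ψ : H ⊗ H ⟶ H ⊗ H} (h : IsLeftLinear ψ) :
    ψ = leftExt (inr H H ≫ ψ) := by
  calc
    ψ = 𝟙 _ ⊗≫ (H ◁ η[H] ≫ μ[H]) ▷ H ⊗≫ ψ := by
      rw [MonObj.mul_one]; monoidal
    _ = 𝟙 _ ⊗≫ H ◁ (η[H] ▷ H) ≫ ((α_ H H H).inv ≫ μ[H] ▷ H) ≫ ψ := by monoidal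
    _ = _ := by
      rw [show _ ≫ ψ = _ from h]
      dsimp only [leftExt, inr]; monoidal

lemma inr_leftExt (f : H ⟶ H ⊗ H) : inr H H ≫ leftExt f = f := by
  calc
    _ = f ≫ (λ_ _).inv ≫ (η[H] ▷ (H ⊗ H) ≫ (α_ H H H).inv ≫ μ[H] ▷ H) := by
      simp [inr, leftExt, ← whisker_exchange_assoc]
    _ = f := by
      rw [associator_inv_naturality_left_assoc, ← comp_whiskerRight, MonObj.one_mul]
      simp

lemma leftExt_injective : Function.Injective (leftExt (H := H)) := fun f g h => by
  rw [← inr_leftExt f, h, inr_leftExt]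

lemma leftExt_comp (f g : H ⟶ H ⊗ H) : leftExt f ≫ leftExt g = leftExt (f ≫ leftExt g) := by
  have h : _ ≫ leftExt g = _ := isLeftLinear_leftExt g
  rw [leftExt, Category.assoc, h, ← whiskerLeft_comp_assoc]
  rfl

variable [CounitalComagma H]

lemma conv_eq (f g : H ⟶ H) : conv f g = (δ[H] ≫ f ▷ H) ≫ H ◁ g ≫ μ[H] := by
  rw [conv, MonoidalCategory.tensorHom_def, Category.assoc, Category.assoc]

lemma leftExt_counit (f : H ⟶ H ⊗ H) : leftExt f ≫ H ◁ ε[H] ≫ (ρ_ H).hom =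
    H ◁ (f ≫ H ◁ ε[H] ≫ (ρ_ H).hom) ≫ μ[H] := by
  calc
    _ = H ◁ f ⊗≫ (μ[H] ▷ H ≫ H ◁ ε[H]) ⊗≫ 𝟙 _ := by
      dsimp only [leftExt]; monoidal
    _ = _ := by rw [← whisker_exchange]; monoidal

lemma comul_whiskerRight_leftExt {f : H ⟶ H} (hf : IsRightColinear (δ[H] ≫ f ▷ H)) (g : H ⟶ H) :
    (δ[H] ≫ f ▷ H) ≫ leftExt (δ[H] ≫ g ▷ H) = δ[H] ≫ conv f g ▷ H := by
  have h : (δ[H] ≫ f ▷ H) ≫ H ◁ δ[H] = δ[H] ≫ (δ[H] ≫ f ▷ H) ▷ H ≫ (α_ H H H).hom := hf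
  rw [leftExt, whiskerLeft_comp_assoc, ← Category.assoc, h, conv,
    MonoidalCategory.tensorHom_def]
  monoidal

lemma comul_leftExt_counit (f g : H ⟶ H) :
    ((δ[H] ≫ f ▷ H) ≫ leftExt (δ[H] ≫ g ▷ H)) ≫ H ◁ ε[H] ≫ (ρ_ H).hom = conv f g := by
  rw [Category.assoc, leftExt_counit, comul_whiskerRight_counit, conv_eq]

lemma comul_leftExt_eq (g : H ⟶ H) : δ[H] ≫ leftExt (δ[H] ≫ g ▷ H) =
    δ[H] ≫ H ◁ δ[H] ≫ (α_ H H H).inv ≫ (H ◁ g) ▷ H ≫ μ[H] ▷ H := by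
  simp [leftExt]

lemma leftExt_comul_eq (f : H ⟶ H) : (δ[H] ≫ f ▷ H) ≫ leftExt δ[H] =
    δ[H] ≫ (f ⊗ₘ δ[H]) ≫ (α_ H H H).inv ≫ μ[H] ▷ H := by
  simp [leftExt, MonoidalCategory.tensorHom_def]

lemma almostRightColinear_leftExt_iff {f : H ⟶ H ⊗ H} : AlmostRightColinear (leftExt f) ↔
    f = δ[H] ≫ (f ≫ H ◁ ε[H] ≫ (ρ_ H).hom) ▷ H := by
  have h : H ◁ δ[H] ≫ (α_ H H H).inv ≫ leftExt f ▷ H ≫ (H ◁ ε[H]) ▷ H ≫ (ρ_ H).hom ▷ H =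
      leftExt (δ[H] ≫ (f ≫ H ◁ ε[H] ≫ (ρ_ H).hom) ▷ H) := by
    rw [← comp_whiskerRight, ← comp_whiskerRight, leftExt_counit]
    dsimp only [leftExt]; monoidal
  rw [AlmostRightColinear, h, leftExt_injective.eq_iff]

lemma IsLeftLinear.almostRightColinear_iff {ψ : H ⊗ H ⟶ H ⊗ H} (hψ : IsLeftLinear ψ) :
    AlmostRightColinear ψ ↔ ∃ lam : H ⟶ H, ψ = leftExt (δ[H] ≫ lam ▷ H) := by
  rw [hψ.eq_leftExt, almostRightColinear_leftExt_iff]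
  refine ⟨fun h => ⟨_, congrArg leftExt h⟩, ?_⟩
  rintro ⟨lam, h⟩
  rw [leftExt_injective h, comul_whiskerRight_counit]

lemma galoisBeta_eq : galoisBeta H = leftExt δ[H] := rfl

end LeftExtension

section Projections

variable {C : Type u} [Category.{v} C] [MonoidalCategory C] {H : C} [MonObj H]
  [CounitalComagma H]

variable (H) in
/-- The element `δ(1)` of `H ⊗ H`. -/
def comulOne : 𝟙_ C ⟶ H ⊗ H :=
  η[H] ≫ δ[H]

lemma unitCopairing_eq (m : H ⊗ H ⟶ H) : unitCopairing H m =
    comulOne H ≫ ((λ_ H).inv ≫ comulOne H ▷ H ≫ (α_ H H H).hom ≫ H ◁ m) ▷ H := by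
  rw [unitCopairing, ← comulOne, MonoidalCategory.tensorHom_def']
  monoidal

variable (H) in
/-- The first equality of (b2), `ε(x y z) = ε(x y₁) ε(y₂ z)`. -/
def WeaklyMultiplicativeCounit : Prop :=
  μ[H] ▷ H ≫ μ[H] ≫ ε[H] = counitPairing H δ[H]

variable [BraidedCategory C]

omit [CounitalComagma H] in
lemma leftExt_inr_mulRight (x : 𝟙_ C ⟶ H ⊗ H) : leftExt (inr H H ≫ mulRight x) = mulRight x := by
  rw [inr_comp_mulRight]
  simp only [leftExt, mulRight, MonObj.tensorObj.mul_def, tensorμ,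
    MonoidalCategory.tensorHom_def']
  monoidal

lemma omegaL1_eq : omegaL1 H = leftExt (δ[H] ≫ piL H ▷ H) := by
  dsimp only [omegaL1, leftExt]; monoidal

lemma omegaR1_eq : omegaR1 H = leftExt (δ[H] ≫ piR H ▷ H) := by
  dsimp only [omegaR1, leftExt]; monoidal

lemma isMulHom_comul (hb1 : CondB1 H) : IsMulHom δ[H] := by
  rwa [IsMulHom, MonObj.tensorObj.mul_def]

lemma comul_mulRight (hb1 : CondB1 H) : δ[H] ≫ mulRight (comulOne H) = δ[H] := by
  rw [comulOne, ← (isMulHom_comul hb1).mulRight_comp, mulRight_one, Category.id_comp]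

lemma comul_mulLeft (hb1 : CondB1 H) : δ[H] ≫ mulLeft (comulOne H) = δ[H] := by
  rw [comulOne, ← (isMulHom_comul hb1).mulLeft_comp, mulLeft_one, Category.id_comp]

lemma comulOne_comul_eq_mulLeft (hb3 : CondB3 H) : comulOne H ≫ H ◁ δ[H] =
    (comulOne H ≫ inr H (H ⊗ H)) ≫
      mulLeft (comulOne H ≫ inl (H ⊗ H) H ≫ (α_ H H H).hom) := by
  have h := (hb3.1.symm.trans hb3.2.1) =≫ (α_ H H H).hom
  rw [unitCopairing_eq, ← inr_comp_mulLeft, Category.assoc (comulOne H),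
    inr_comp_mulLeft_whiskerRight] at h
  simpa [comulOne] using h

lemma comulOne_comul_eq_mulRight (hb3 : CondB3 H) : comulOne H ≫ H ◁ δ[H] =
    (comulOne H ≫ inr H (H ⊗ H)) ≫
      mulRight (comulOne H ≫ inl (H ⊗ H) H ≫ (α_ H H H).hom) := by
  have h := (hb3.1.symm.trans hb3.2.2) =≫ (α_ H H H).hom
  rw [unitCopairing_eq, ← inr_comp_mulRight_eq_braiding_inv, Category.assoc (comulOne H),
    inr_comp_mulRight_whiskerRight] at h
  simpa [comulOne] using h

lemma isRightColinear_inr_mulRight (hb1 : CondB1 H) (hb3 : CondB3 H) :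
    IsRightColinear (inr H H ≫ mulRight (comulOne H)) := by
  rw [IsRightColinear, Category.assoc, (isMulHom_comul hb1).whiskerLeft.mulRight_comp,
    comulOne_comul_eq_mulRight hb3, ← mulRight_comp_mulRight, ← reassoc_of% comp_inr,
    ← reassoc_of% isMulHom_inr.mulRight_comp, reassoc_of% comul_mulRight hb1,
    ← inr_comp_mulRight_whiskerRight]

lemma isRightColinear_inr_mulLeft (hb1 : CondB1 H) (hb3 : CondB3 H) :
    IsRightColinear (inr H H ≫ mulLeft (comulOne H)) := by
  rw [IsRightColinear, Category.assoc, (isMulHom_comul hb1).whiskerLeft.mulLeft_comp,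
    comulOne_comul_eq_mulLeft hb3, ← mulLeft_comp_mulLeft, ← reassoc_of% comp_inr,
    ← reassoc_of% isMulHom_inr.mulLeft_comp, reassoc_of% comul_mulLeft hb1,
    ← inr_comp_mulLeft_whiskerRight]

lemma inr_mulRight_counit :
    inr H H ≫ mulRight (comulOne H) ≫ H ◁ ε[H] ≫ (ρ_ H).hom = piR H := by
  simp [reassoc_of% inr_comp_mulRight, piR, comulOne]

lemma comul_piR (hb1 : CondB1 H) (hb3 : CondB3 H) :
    δ[H] ≫ piR H ▷ H = inr H H ≫ mulRight (comulOne H) := by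
  rw [(isRightColinear_inr_mulRight hb1 hb3).eq_comul_whiskerRight, Category.assoc,
    inr_mulRight_counit]

lemma isRightColinear_comul_piR (hb1 : CondB1 H) (hb3 : CondB3 H) :
    IsRightColinear (δ[H] ≫ piR H ▷ H) := by
  rw [comul_piR hb1 hb3]
  exact isRightColinear_inr_mulRight hb1 hb3

lemma whiskerLeft_piR_mul :
    H ◁ piR H ≫ μ[H] = mulRight (comulOne H) ≫ H ◁ ε[H] ≫ (ρ_ H).hom := by
  rw [← leftExt_inr_mulRight, leftExt_counit, Category.assoc, inr_mulRight_counit]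

lemma conv_id_piR (hb1 : CondB1 H) : conv (𝟙 H) (piR H) = 𝟙 H := by
  rw [conv_eq, whiskerLeft_piR_mul, id_whiskerRight, Category.comp_id,
    reassoc_of% comul_mulRight hb1, CounitalComagma.comul_counit]

lemma conv_piR_piR (hb1 : CondB1 H) (hb3 : CondB3 H) : conv (piR H) (piR H) = piR H := by
  have h : comulOne H ≫ mulRight (comulOne H) = comulOne H := by
    rw [comulOne, Category.assoc]; exact congrArg (η[H] ≫ ·) (comul_mulRight hb1)
  rw [conv_eq, comul_piR hb1 hb3, whiskerLeft_piR_mul, Category.assoc,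
    reassoc_of% mulRight_comp_mulRight, h, inr_mulRight_counit]

lemma comul_leftExt_piR (hb1 : CondB1 H) (hb3 : CondB3 H) :
    δ[H] ≫ leftExt (δ[H] ≫ piR H ▷ H) = δ[H] := by
  rw [comul_piR hb1 hb3, leftExt_inr_mulRight, comul_mulRight hb1]

variable (H) in
/-- The morphism `h ↦ 1₁ ε(1₂ h)`, a variant of `Π^L` for which colinearity is easier to see. -/
def piLBar : H ⟶ H :=
  inr H H ≫ mulLeft (comulOne H) ≫ H ◁ ε[H] ≫ (ρ_ H).hom

lemma whiskerLeft_piLBar_mul_counit (hb2 : WeaklyMultiplicativeCounit H) :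
    H ◁ piLBar H ≫ μ[H] ≫ ε[H] = μ[H] ≫ ε[H] := by
  calc
    _ = H ◁ (λ_ H).inv ≫ (α_ H (𝟙_ C) H).inv ≫ (H ◁ η[H]) ▷ H ≫ counitPairing H δ[H] := by
      rw [piLBar, reassoc_of% inr_comp_mulLeft, comulOne, counitPairing]
      simp only [MonoidalCategory.tensorHom_def']
      monoidal
    _ = _ := by
      rw [← show _ = counitPairing H δ[H] from hb2, ← comp_whiskerRight_assoc, MonObj.mul_one]
      simp

lemma piLBar_piL (hb2 : WeaklyMultiplicativeCounit H) :
    piLBar H ≫ piL H = piL H := by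
  calc
    _ = (λ_ H).inv ≫ comulOne H ▷ H ≫ (α_ H H H).hom ≫ H ◁ (β_ H H).hom ≫ (α_ H H H).inv ≫
      (H ◁ piLBar H ≫ μ[H] ≫ ε[H]) ▷ H ≫ (λ_ H).hom := by
      rw [piL, leftUnitor_inv_naturality_assoc, whisker_exchange_assoc,
        associator_naturality_right_assoc, ← whiskerLeft_comp_assoc,
        BraidedCategory.braiding_naturality_right]
      simp [comulOne]
    _ = piL H := by rw [whiskerLeft_piLBar_mul_counit hb2]; rfl

lemma isRightColinear_comul_piL (hb1 : CondB1 H)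
    (hb2 : WeaklyMultiplicativeCounit H) (hb3 : CondB3 H) :
    IsRightColinear (δ[H] ≫ piL H ▷ H) := by
  have h := (isRightColinear_inr_mulLeft hb1 hb3).whiskerRight (piL H)
  have hc : ((inr H H ≫ mulLeft (comulOne H)) ≫ piL H ▷ H) ≫ H ◁ ε[H] ≫ (ρ_ H).hom = piL H := by
    conv_rhs => rw [← piLBar_piL hb2, piLBar]
    simp only [Category.assoc, ← whisker_exchange_assoc, rightUnitor_naturality]
  have hp := h.eq_comul_whiskerRight
  rw [hc] at hp
  rwa [← hp]

end Projections

open MonoidalOpposite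

section Opposite

variable {C : Type u} [Category.{v} C] [MonoidalCategory C] {H : C} [CounitalComagma H]

/-- The counital comagma on `mop H` with the same comultiplication and counit. Passing from `H` to
`mop H` reverses tensor products but not arrows; it exchanges `Π^L` with `Π^R`, `Ω_L^1` with
`Ω_R^2`, `Ω_R^1` with `Ω_L^2` and `β` with `γ`, all definitionally. -/
instance mopComagma : CounitalComagma (mop H) where
  counit := (ε[H]).mop
  comul := (δ[H]).mop
  counit_comul := congrArg Quiver.Hom.mop CounitalComagma.comul_counit
  comul_counit := congrArg Quiver.Hom.mop CounitalComagma.counit_comul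

lemma almostRightColinear_mop {φ : H ⊗ H ⟶ H ⊗ H} :
    AlmostRightColinear (H := mop H) φ.mop ↔ AlmostLeftColinear φ :=
  ⟨fun h => congrArg Quiver.Hom.unmop h, fun h => congrArg Quiver.Hom.mop h⟩

variable [MonObj H]

lemma counitPairing_mop (d : H ⟶ H ⊗ H) :
    counitPairing (mop H) d.mop = ((α_ H H H).inv ≫ counitPairing H d).mop := by
  have h : H ◁ (d ▷ H) ≫ H ◁ (α_ H H H).hom ≫ (α_ H H (H ⊗ H)).inv ≫
      ((μ[H] ≫ ε[H]) ⊗ₘ (μ[H] ≫ ε[H])) ≫ (ρ_ (𝟙_ C)).hom =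
        (α_ H H H).inv ≫ counitPairing H d := by
    dsimp only [counitPairing]
    monoidal
  exact congrArg Quiver.Hom.mop h

lemma unitCopairing_mop (m : H ⊗ H ⟶ H) :
    unitCopairing (mop H) m.mop = (unitCopairing H m ≫ (α_ H H H).hom).mop := by
  have h : (ρ_ (𝟙_ C)).inv ≫ ((η[H] ≫ δ[H]) ⊗ₘ (η[H] ≫ δ[H])) ≫ (α_ H H (H ⊗ H)).hom ≫
      H ◁ (α_ H H H).inv ≫ H ◁ (m ▷ H) = unitCopairing H m ≫ (α_ H H H).hom := by
    dsimp only [unitCopairing]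
    monoidal
  exact congrArg Quiver.Hom.mop h

lemma WeaklyMultiplicativeCounit.mop (hb2 : WeaklyMultiplicativeCounit H) :
    WeaklyMultiplicativeCounit (mop H) := by
  refine Eq.trans ?_ (counitPairing_mop δ[H]).symm
  have h : H ◁ μ[H] ≫ μ[H] ≫ ε[H] = (α_ H H H).inv ≫ counitPairing H δ[H] := by
    rw [← show _ = counitPairing H δ[H] from hb2, MonObj.mul_assoc_assoc, Iso.inv_hom_id_assoc]
  exact congrArg Quiver.Hom.mop h

variable [BraidedCategory C]

omit [MonObj H] [CounitalComagma H] in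
lemma tensorμ_mop (W X Y Z : C) :
    tensorμ (mop W) (mop X) (mop Y) (mop Z) = (tensorμ Z Y X W).mop := by
  apply Quiver.Hom.unmop_inj
  simp [tensorμ]

lemma condB1_mop (hb1 : CondB1 H) : CondB1 (mop H) := by
  rw [CondB1, tensorμ_mop]
  exact congrArg Quiver.Hom.mop hb1

lemma condB3_mop (hb3 : CondB3 H) : CondB3 (mop H) := by
  obtain ⟨h₁, h₂, h₃⟩ := hb3
  have h : η[H] ≫ δ[H] ≫ H ◁ δ[H] = (η[H] ≫ δ[H] ≫ δ[H] ▷ H) ≫ (α_ H H H).hom := by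
    simp [h₁]
  refine ⟨?_, ?_, ?_⟩
  · exact congrArg Quiver.Hom.mop (h.trans (by simp only [Category.assoc]; rfl))
  · exact (congrArg Quiver.Hom.mop (h.trans (h₂ =≫ _))).trans (unitCopairing_mop _).symm
  · exact (congrArg Quiver.Hom.mop (h.trans (h₃ =≫ _))).trans (unitCopairing_mop _).symm

lemma conv_piL_id (hb1 : CondB1 H) : conv (piL H) (𝟙 H) = 𝟙 H :=
  congrArg Quiver.Hom.unmop (conv_id_piR (condB1_mop hb1))

lemma conv_piL_piL (hb1 : CondB1 H) (hb3 : CondB3 H) : conv (piL H) (piL H) = piL H :=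
  congrArg Quiver.Hom.unmop (conv_piR_piR (condB1_mop hb1) (condB3_mop hb3))

end Opposite

section Antipode

variable {C : Type u} [Category.{v} C] [MonoidalCategory C] [BraidedCategory C] {H : C}
  [MonObj H] [CounitalComagma H]

lemma omegaL1_idem (hb1 : CondB1 H) (hb2 : WeaklyMultiplicativeCounit H) (hb3 : CondB3 H) :
    omegaL1 H ≫ omegaL1 H = omegaL1 H := by
  rw [omegaL1_eq, leftExt_comp, comul_whiskerRight_leftExt (isRightColinear_comul_piL hb1 hb2 hb3),
    conv_piL_piL hb1 hb3]

lemma omegaR1_idem (hb1 : CondB1 H) (hb3 : CondB3 H) : omegaR1 H ≫ omegaR1 H = omegaR1 H := by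
  rw [omegaR1_eq, leftExt_comp, comul_whiskerRight_leftExt (isRightColinear_comul_piR hb1 hb3),
    conv_piR_piR hb1 hb3]

lemma omegaL2_idem (hb1 : CondB1 H) (hb3 : CondB3 H) : omegaL2 H ≫ omegaL2 H = omegaL2 H :=
  congrArg Quiver.Hom.unmop (omegaR1_idem (condB1_mop hb1) (condB3_mop hb3))

lemma omegaR2_idem (hb1 : CondB1 H) (hb2 : WeaklyMultiplicativeCounit H) (hb3 : CondB3 H) :
    omegaR2 H ≫ omegaR2 H = omegaR2 H :=
  congrArg Quiver.Hom.unmop (omegaL1_idem (condB1_mop hb1) hb2.mop (condB3_mop hb3))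

lemma omegaL1_galoisBeta (hb1 : CondB1 H) (hb2 : WeaklyMultiplicativeCounit H) (hb3 : CondB3 H) :
    omegaL1 H ≫ galoisBeta H = galoisBeta H := by
  have h := comul_whiskerRight_leftExt (isRightColinear_comul_piL hb1 hb2 hb3) (𝟙 H)
  rw [conv_piL_id hb1, id_whiskerRight, Category.comp_id] at h
  rw [omegaL1_eq, galoisBeta_eq, leftExt_comp, h]

lemma galoisBeta_omegaR1 (hb1 : CondB1 H) (hb3 : CondB3 H) :
    galoisBeta H ≫ omegaR1 H = galoisBeta H := by
  rw [omegaR1_eq, galoisBeta_eq, leftExt_comp, comul_leftExt_piR hb1 hb3]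

/-- The part of the antipode axioms which governs the right Galois morphism `β`. The other part is
the same notion for `lam.mop : mop H ⟶ mop H`. -/
structure IsLeftAntipode (lam : H ⟶ H) : Prop where
  conv_piL : conv lam (piL H) = lam
  piR_conv : conv (piR H) lam = lam
  comul_leftExt : δ[H] ≫ leftExt (δ[H] ≫ lam ▷ H) = δ[H] ≫ piL H ▷ H
  leftExt_comul : (δ[H] ≫ lam ▷ H) ≫ leftExt δ[H] = δ[H] ≫ piR H ▷ H

namespace IsLeftAntipode

variable {lam lam' : H ⟶ H}

lemma id_conv (h : IsLeftAntipode lam) : conv (𝟙 H) lam = piL H := by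
  rw [← comul_leftExt_counit, id_whiskerRight, Category.comp_id, h.comul_leftExt,
    comul_whiskerRight_counit]

lemma conv_id (h : IsLeftAntipode lam) : conv lam (𝟙 H) = piR H := by
  rw [← comul_leftExt_counit, id_whiskerRight, Category.comp_id, h.leftExt_comul,
    comul_whiskerRight_counit]

lemma eq_of_mop (h : IsLeftAntipode lam) (h' : IsLeftAntipode lam'.mop) : lam = lam' := by
  have id_conv : conv (𝟙 H) lam' = piL H := congrArg Quiver.Hom.unmop h'.conv_id
  have piR_conv : conv (piR H) lam' = lam' := congrArg Quiver.Hom.unmop h'.conv_piL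
  calc
    lam = 𝟙 _ ⊗≫ (δ[H] ≫ lam ▷ H) ⊗≫ H ◁ (δ[H] ≫ H ◁ lam') ⊗≫
        ((α_ H H H).hom ≫ H ◁ μ[H] ≫ μ[H]) := by
      conv_lhs => rw [← h.conv_piL, ← id_conv, conv_eq, conv_eq]
      monoidal
    _ = 𝟙 _ ⊗≫ (δ[H] ≫ lam ▷ H) ⊗≫ H ◁ δ[H] ⊗≫ ((H ⊗ H) ◁ lam' ≫ μ[H] ▷ H) ≫ μ[H] := by
      rw [← MonObj.mul_assoc]; monoidal
    _ = ((δ[H] ≫ lam ▷ H) ≫ leftExt δ[H]) ≫ H ◁ lam' ≫ μ[H] := by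
      rw [whisker_exchange]; dsimp only [leftExt]; monoidal
    _ = lam' := by rw [h.leftExt_comul, ← conv_eq, piR_conv]

end IsLeftAntipode

lemma isLeftAntipode_iff_isKaroubiInverse (hb1 : CondB1 H) (hb3 : CondB3 H) {lam : H ⟶ H} :
    IsLeftAntipode lam ↔
      IsKaroubiInverse (omegaL1 H) (omegaR1 H) (galoisBeta H) (leftExt (δ[H] ≫ lam ▷ H)) := by
  have comp_inv : δ[H] ≫ conv (piR H) lam ▷ H =
      (δ[H] ≫ piR H ▷ H) ≫ leftExt (δ[H] ≫ lam ▷ H) :=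
    (comul_whiskerRight_leftExt (isRightColinear_comul_piR hb1 hb3) lam).symm
  rw [omegaL1_eq, omegaR1_eq, galoisBeta_eq]
  constructor
  · intro h
    constructor
    · rw [leftExt_comp, h.comul_leftExt]
    · rw [leftExt_comp, h.leftExt_comul]
    · rw [leftExt_comp, ← comp_inv, h.piR_conv]
  · intro h
    have inv_comp := h.inv_comp
    obtain ⟨hom_inv_id, inv_hom_id, h'⟩ := h
    rw [leftExt_comp] at hom_inv_id inv_hom_id h' inv_comp
    refine ⟨?_, ?_, leftExt_injective hom_inv_id, leftExt_injective inv_hom_id⟩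
    · rw [← comul_leftExt_counit, leftExt_injective inv_comp, comul_whiskerRight_counit]
    · rw [← comul_leftExt_counit, leftExt_injective h', comul_whiskerRight_counit]

lemma IsAntipode.isLeftAntipode {lam : H ⟶ H} (h : IsAntipode H lam) : IsLeftAntipode lam where
  conv_piL := h.conv_piL
  piR_conv := h.piR_conv
  comul_leftExt := (comul_leftExt_eq lam).trans h.left_piL
  leftExt_comul := (leftExt_comul_eq lam).trans h.left_piR

lemma IsAntipode.mop {lam : H ⟶ H} (h : IsAntipode H lam) : IsAntipode (mop H) lam.mop where
  id_conv := congrArg Quiver.Hom.mop h.conv_id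
  conv_id := congrArg Quiver.Hom.mop h.id_conv
  conv_piL := congrArg Quiver.Hom.mop h.piR_conv
  piR_conv := congrArg Quiver.Hom.mop h.conv_piL
  left_piR := congrArg Quiver.Hom.mop h.right_piL
  left_piL := congrArg Quiver.Hom.mop h.right_piR
  right_piL := congrArg Quiver.Hom.mop h.left_piR
  right_piR := congrArg Quiver.Hom.mop h.left_piL

lemma isAntipode_iff {lam : H ⟶ H} :
    IsAntipode H lam ↔ IsLeftAntipode lam ∧ IsLeftAntipode lam.mop := by
  refine ⟨fun h => ⟨h.isLeftAntipode, h.mop.isLeftAntipode⟩, fun ⟨h, h'⟩ => ?_⟩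
  exact
    { id_conv := h.id_conv.symm
      conv_id := h.conv_id.symm
      conv_piL := h.conv_piL
      piR_conv := h.piR_conv
      left_piR := (leftExt_comul_eq lam).symm.trans h.leftExt_comul
      left_piL := (comul_leftExt_eq lam).symm.trans h.comul_leftExt
      right_piL :=
        congrArg Quiver.Hom.unmop ((leftExt_comul_eq lam.mop).symm.trans h'.leftExt_comul)
      right_piR :=
        congrArg Quiver.Hom.unmop ((comul_leftExt_eq lam.mop).symm.trans h'.comul_leftExt) }

lemma exists_isAntipode_iff : (∃ lam : H ⟶ H, IsAntipode H lam) ↔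
    (∃ lam : mop H ⟶ mop H, IsLeftAntipode lam) ∧ ∃ lam : H ⟶ H, IsLeftAntipode lam := by
  constructor
  · rintro ⟨lam, h⟩
    exact ⟨⟨lam.mop, h.mop.isLeftAntipode⟩, ⟨lam, h.isLeftAntipode⟩⟩
  · rintro ⟨⟨lam', h'⟩, ⟨lam, h⟩⟩
    obtain rfl := h.eq_of_mop (lam' := lam'.unmop) h'
    exact ⟨_, isAntipode_iff.2 ⟨h, h'⟩⟩

lemma isLeftLinear_of_isKaroubiInverse {ψ : H ⊗ H ⟶ H ⊗ H}
    (h : IsKaroubiInverse (omegaL1 H) (omegaR1 H) (galoisBeta H) ψ) : IsLeftLinear ψ := by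
  rw [omegaL1_eq, omegaR1_eq, galoisBeta_eq] at h
  exact h.map_comp (T := tensorLeft H) (isLeftLinear_leftExt _) (isLeftLinear_leftExt _)
    (isLeftLinear_leftExt _)

lemma exists_isLeftAntipode_iff (hb1 : CondB1 H) (hb2 : WeaklyMultiplicativeCounit H)
    (hb3 : CondB3 H) (L : Splitting (omegaL1 H)) (R : Splitting (omegaR1 H)) :
    (∃ lam : H ⟶ H, IsLeftAntipode lam) ↔ ∃ _ : IsIso (L.j ≫ galoisBeta H ≫ R.q),
      AlmostRightColinear (R.q ≫ inv (L.j ≫ galoisBeta H ≫ R.q) ≫ L.j) := by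
  constructor
  · rintro ⟨lam, h⟩
    have hK := (isLeftAntipode_iff_isKaroubiInverse hb1 hb3).1 h
    obtain ⟨hs, hψ⟩ := hK.exists_isIso L R
    refine ⟨hs, ?_⟩
    rw [hψ]
    exact (isLeftLinear_leftExt _).almostRightColinear_iff.2 ⟨lam, rfl⟩
  · rintro ⟨hs, hψ⟩
    have hK := isKaroubiInverse_of_isIso L R (omegaL1_galoisBeta hb1 hb2 hb3)
      (galoisBeta_omegaR1 hb1 hb3)
    obtain ⟨lam, h⟩ := (isLeftLinear_of_isKaroubiInverse hK).almostRightColinear_iff.1 hψ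
    rw [h] at hK
    exact ⟨lam, (isLeftAntipode_iff_isKaroubiInverse hb1 hb3).2 hK⟩

lemma exists_isLeftAntipode_mop_iff (hb1 : CondB1 H) (hb2 : WeaklyMultiplicativeCounit H)
    (hb3 : CondB3 H) (L : Splitting (omegaL2 H)) (R : Splitting (omegaR2 H)) :
    (∃ lam : mop H ⟶ mop H, IsLeftAntipode lam) ↔ ∃ _ : IsIso (R.j ≫ galoisGamma H ≫ L.q),
      AlmostLeftColinear (L.q ≫ inv (R.j ≫ galoisGamma H ≫ L.q) ≫ R.j) := by
  rw [exists_isLeftAntipode_iff (condB1_mop hb1) hb2.mop (condB3_mop hb3) R.mop L.mop]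
  change (∃ _ : IsIso (R.j ≫ galoisGamma H ≫ L.q).mop, AlmostRightColinear (H := mop H)
    (L.q.mop ≫ inv (R.j ≫ galoisGamma H ≫ L.q).mop ≫ R.j.mop)) ↔ _
  constructor
  · rintro ⟨hh, hφ⟩
    have hh' : IsIso (R.j ≫ galoisGamma H ≫ L.q) :=
      inferInstanceAs (IsIso (R.j ≫ galoisGamma H ≫ L.q).mop.unmop)
    rw [inv_mop] at hφ
    exact ⟨hh', almostRightColinear_mop.1 hφ⟩
  · rintro ⟨hh, hφ⟩
    refine ⟨inferInstance, ?_⟩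
    rw [inv_mop]
    exact almostRightColinear_mop.2 hφ

lemma isWeakHopfCoquasigroup_iff (hb1 : CondB1 H) (hb2 : CondB2 H) (hb3 : CondB3 H) :
    IsWeakHopfCoquasigroup H ↔ ∃ lam : H ⟶ H, IsAntipode H lam :=
  ⟨fun h => h.exists_antipode, fun h => ⟨hb1, hb2, hb3, h⟩⟩

end Antipode

end WeakHopf

theorem theorem3_general {C : Type u} [Category.{v} C] [MonoidalCategory C] [BraidedCategory C]
    (H : C) [MonObj H] [CounitalComagma H] (hb1 : WeakHopf.CondB1 H)
    (hb2 : WeakHopf.WeaklyMultiplicativeCounit H) (hb3 : WeakHopf.CondB3 H) :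
    (WeakHopf.omegaL1 H ≫ WeakHopf.omegaL1 H = WeakHopf.omegaL1 H ∧
      WeakHopf.omegaR1 H ≫ WeakHopf.omegaR1 H = WeakHopf.omegaR1 H ∧
      WeakHopf.omegaL2 H ≫ WeakHopf.omegaL2 H = WeakHopf.omegaL2 H ∧
      WeakHopf.omegaR2 H ≫ WeakHopf.omegaR2 H = WeakHopf.omegaR2 H) ∧
    ∀ (L1 : Splitting (WeakHopf.omegaL1 H)) (R1 : Splitting (WeakHopf.omegaR1 H))
      (L2 : Splitting (WeakHopf.omegaL2 H)) (R2 : Splitting (WeakHopf.omegaR2 H))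
      (h : R2.obj ⟶ L2.obj) (s : L1.obj ⟶ R1.obj),
      h = R2.j ≫ WeakHopf.galoisGamma H ≫ L2.q →
      s = L1.j ≫ WeakHopf.galoisBeta H ≫ R1.q →
      ((∃ lam : H ⟶ H, WeakHopf.IsAntipode H lam) ↔
        ∃ (_ : IsIso h) (_ : IsIso s),
          WeakHopf.AlmostLeftColinear (L2.q ≫ inv h ≫ R2.j) ∧
          WeakHopf.AlmostRightColinear (R1.q ≫ inv s ≫ L1.j)) := by
  refine ⟨⟨WeakHopf.omegaL1_idem hb1 hb2 hb3, WeakHopf.omegaR1_idem hb1 hb3,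
    WeakHopf.omegaL2_idem hb1 hb3, WeakHopf.omegaR2_idem hb1 hb2 hb3⟩, ?_⟩
  rintro L1 R1 L2 R2 h s rfl rfl
  rw [WeakHopf.exists_isAntipode_iff,
    WeakHopf.exists_isLeftAntipode_mop_iff hb1 hb2 hb3 L2 R2,
    WeakHopf.exists_isLeftAntipode_iff hb1 hb2 hb3 L1 R1]
  exact ⟨fun ⟨⟨hh, hφ⟩, hs, hψ⟩ => ⟨hh, hs, hφ, hψ⟩, fun ⟨hh, hs, hφ, hψ⟩ => ⟨⟨hh, hφ⟩, hs, hψ⟩⟩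

theorem theorem3 {C : Type u} [Category.{v} C] [MonoidalCategory C] [BraidedCategory C]
    [HasEqualizers C] [HasCoequalizers C] (H : C) [MonObj H] [CounitalComagma H]
    (hb1 : WeakHopf.CondB1 H) (hb2 : WeakHopf.CondB2 H) (hb3 : WeakHopf.CondB3 H) :
    -- the four idempotents split, so the objects below exist
    (Nonempty (Splitting (WeakHopf.omegaL1 H)) ∧ Nonempty (Splitting (WeakHopf.omegaR1 H)) ∧
      Nonempty (Splitting (WeakHopf.omegaL2 H)) ∧ Nonempty (Splitting (WeakHopf.omegaR2 H))) ∧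
    -- for every choice of the splittings `(obj, j, q)`
    ∀ (L1 : Splitting (WeakHopf.omegaL1 H)) (R1 : Splitting (WeakHopf.omegaR1 H))
      (L2 : Splitting (WeakHopf.omegaL2 H)) (R2 : Splitting (WeakHopf.omegaR2 H))
      (h : R2.obj ⟶ L2.obj) (s : L1.obj ⟶ R1.obj),
      h = R2.j ≫ WeakHopf.galoisGamma H ≫ L2.q →
      s = L1.j ≫ WeakHopf.galoisBeta H ≫ R1.q →
      (WeakHopf.IsWeakHopfCoquasigroup H ↔
        ∃ (_ : IsIso h) (_ : IsIso s),
          WeakHopf.AlmostLeftColinear (L2.q ≫ inv h ≫ R2.j) ∧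
          WeakHopf.AlmostRightColinear (R1.q ≫ inv s ≫ L1.j)) := by
  have : IsIdempotentComplete C :=
    (Idempotents.isIdempotentComplete_iff_hasEqualizer_of_id_and_idempotent C).2
      fun _ _ _ => inferInstance
  obtain ⟨⟨hL1, hR1, hL2, hR2⟩, h⟩ := theorem3_general H hb1 hb2.1 hb3
  refine ⟨⟨Splitting.nonempty_of_idem hL1, Splitting.nonempty_of_idem hR1,
    Splitting.nonempty_of_idem hL2, Splitting.nonempty_of_idem hR2⟩, ?_⟩
  exact fun L1 R1 L2 R2 f s hf hs =>
    (WeakHopf.isWeakHopfCoquasigroup_iff hb1 hb2 hb3).trans (h L1 R1 L2 R2 f s hf hs)
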